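/- Let $X$ be a non-empty compact metric space and $T\colon X\to X$ a homeomorphism. For non-empty open sets $U,V\subset X$ put $N(U,V)=\{n\in\mathbb Z : T^n(U)\cap V\neq\emptyset\}$. The upper Banach density of $A\subset\mathbb Z$ is $d^*(A)=\limsup_{M-N\to\infty}\frac{|A\cap[N,M]|}{M-N+1}$. A set $B\subset\mathbb Z$ is a Bohr set if there are $m\in\mathbb N$, $\alpha\in\mathbb T^m$ (where $\mathbb T=\{z\in\mathbb C:|z|=1\}$, and $\mathbb T^m$ is written additively) and an open set $W\subset\mathbb T^m$ such that $\{n\in\mathbb Z : n\alpha\in W\}$ is non-empty and contained in $B$. The system $(X,T)$ is weakly scattering if $N(U,V)\cap B\neq\emptyset$ for all non-empty open $U,V\subset X$ and every Bohr set $B$. It is strongly scattering if for every finite open cover $\mathcal U$ of $X$ none of whose members is dense in $X$, and every infinite sequence $A=\{a_1,a_2,\dots\}\subset\mathbb N$ of distinct numbers with $d^*(A)>0$, $$\lim_{n\to\infty}\mathcal N\Big(\bigvee_{i=1}^{n}T^{-a_i}\mathcal U\Big)=\infty ,$$ where $\mathcal N(\mathcal V)$ denotes the least cardinality of a subcover of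 the cover $\mathcal V$. Suppose that $(X,T)$ is weakly scattering and that $d^*(N(U,V)\cap B)>0$ for all non-empty open sets $U,V\subset X$ and every Bohr set $B$. Then $(X,T)$ is strongly scattering. -/

import Mathlib

open Set Filter Topology

noncomputable section

namespace TopDyn

/-- The upper Banach density `d*(A)`: the limsup of `|A ∩ [N, M]| / (M - N + 1)` as
`M - N → ∞`. A pair `p` stands for `(N, M)`. -/
def upperBanachDensity (A : Set ℤ) : ℝ :=
  limsup (fun p : ℤ × ℤ => ((A ∩ Icc p.1 p.2).ncard : ℝ) / ((p.2 : ℝ) - (p.1 : ℝ) + 1))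
    (comap (fun p : ℤ × ℤ => p.2 - p.1) atTop)

/-- A set of integers is a Bohr set if it contains a nonempty set of the form
`{n | α ^ n ∈ U}`, with `α` in a finite-dimensional torus and `U` an open subset of it
(the torus is written multiplicatively). -/
def IsBohrSet (E : Set ℤ) : Prop :=
  ∃ (m : ℕ) (α : Fin m → Circle) (U : Set (Fin m → Circle)),
    IsOpen U ∧ {n : ℤ | α ^ n ∈ U}.Nonempty ∧ {n : ℤ | α ^ n ∈ U} ⊆ E

/-- The dual of a family: the sets of integers that meet every member of the family. -/
def dualFamily (F : Set (Set ℤ)) : Set (Set ℤ) :=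
  {G | ∀ E ∈ F, (G ∩ E).Nonempty}

variable {X : Type*} [TopologicalSpace X]

/-- The set of return times `N(U, V) = {n : ℤ | Tⁿ U ∩ V ≠ ∅}`. -/
def returnTimes (T : X ≃ₜ X) (U V : Set X) : Set ℤ :=
  {n | (((T ^ n : X ≃ₜ X) '' U) ∩ V).Nonempty}

/-- `F`-transitivity: `N(U, V) ∈ F` for all nonempty open `U`, `V`. -/
def IsFamilyTransitive (F : Set (Set ℤ)) (T : X ≃ₜ X) : Prop :=
  ∀ U V : Set X, IsOpen U → U.Nonempty → IsOpen V → V.Nonempty → returnTimes T U V ∈ F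

/-- Weak scattering: `Bohr*`-transitivity. -/
def IsWeaklyScattering (T : X ≃ₜ X) : Prop :=
  IsFamilyTransitive (dualFamily {E | IsBohrSet E}) T

/-- A finite nontrivial open cover: finitely many open sets, none of them dense, with union
the whole space. -/
structure IsNontrivialCover (𝒰 : Set (Set X)) : Prop where
  finite : 𝒰.Finite
  isOpen : ∀ U ∈ 𝒰, IsOpen U
  cover : ⋃₀ 𝒰 = univ
  not_dense : ∀ U ∈ 𝒰, ¬ Dense U

/-- The least cardinality of a subcover of `𝒰`. -/
def coverNumber (𝒰 : Set (Set X)) : ℕ∞ :=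
  sInf {k : ℕ∞ | ∃ 𝒱 : Set (Set X), 𝒱 ⊆ 𝒰 ∧ ⋃₀ 𝒱 = univ ∧ 𝒱.encard = k}

/-- The join of the covers `T^{-a 0} 𝒰, …, T^{-a (n-1)} 𝒰`: all intersections
`⋂ i < n, T^{-a i} (s i)` with each `s i ∈ 𝒰`. -/
def joinAlong (T : X ≃ₜ X) (𝒰 : Set (Set X)) (a : ℕ → ℕ) (n : ℕ) : Set (Set X) :=
  {W | ∃ s : Fin n → Set X, (∀ i, s i ∈ 𝒰) ∧
    W = ⋂ i : Fin n, (T ^ (a i) : X ≃ₜ X) ⁻¹' (s i)}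

/-- Strong scattering: for each finite nontrivial open cover and each infinite sequence
`A = {a 0, a 1, …}` of natural numbers with positive upper Banach density, the complexity
function of the cover along `A` is infinite. -/
def IsStronglyScattering (T : X ≃ₜ X) : Prop :=
  ∀ 𝒰 : Set (Set X), IsNontrivialCover 𝒰 →
    ∀ a : ℕ → ℕ, Function.Injective a →
      0 < upperBanachDensity (range (fun i => (a i : ℤ))) →
        Tendsto (fun n => coverNumber (joinAlong T 𝒰 a n)) atTop (𝓝 ⊤)

end TopDyn

end

/-! ### Invariant measures as limits of empirical measures -/

namespace TopDyn

open MeasureTheory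

/-! Suppose the complexity along `A` does not tend to infinity. Then some fixed `K` works for every
finite part of `A`: `K` itineraries through the closed sets `closure (U i)` cover `X`. Such families
of itineraries, together with the set of times they mark, form a compact shift-invariant space
(`coveringCodes`). Since `A` has positive upper Banach density, Krylov–Bogolyubov yields a
shift-invariant measure charging the codes marked at time `0`.

By Baire, in each code one of the `K` closed itinerary sets contains a basic open set `V`. Countably
many choices of `V`, itinerary `j` and symbol `u` are possible, so some `cylinder` has positive
measure. If a code and its shift by `n` both lie in it, then `T^n V` is contained in `closure (U
u)`. Thus the times in `N(V, (closure (U u))ᶜ)` are never return times of the cylinder.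

By Følner's theorem (`exists_isBohrSet_of_stationary`), proved from Herglotz and Wiener, return
times of a set of positive measure fill a Bohr set `B` up to upper Banach density zero. Hence `N(V,
(closure (U u))ᶜ) ∩ B` has density zero, contrary to the hypothesis; the second set is nonempty
because `U u` is not dense. -/

theorem exists_tendsto_hyperfilter {Y : Type*} [TopologicalSpace Y] [CompactSpace Y]
    (u : ℕ → Y) : ∃ y, Tendsto u (hyperfilter ℕ : Filter ℕ) (𝓝 y) :=
  ⟨_, ((hyperfilter ℕ).map u).le_nhds_lim⟩

/-- The uniform measure on the orbit segment `y, S y, …, S^[ℓ - 1] y`. -/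
noncomputable def empiricalMeasure {Y : Type*} [MeasurableSpace Y] (S : Y → Y) (ℓ : ℕ) (y : Y) :
    Measure Y :=
  (ℓ : ENNReal)⁻¹ • ∑ i ∈ Finset.range ℓ, Measure.dirac (S^[i] y)

theorem isProbabilityMeasure_empiricalMeasure {Y : Type*} [MeasurableSpace Y] (S : Y → Y)
    {ℓ : ℕ} (hℓ : 0 < ℓ) (y : Y) : IsProbabilityMeasure (empiricalMeasure S ℓ y) := by
  constructor
  simp only [empiricalMeasure, Measure.smul_apply, Measure.finsetSum_apply, measure_univ,
    Finset.sum_const, Finset.card_range, nsmul_eq_mul, mul_one, smul_eq_mul]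
  exact ENNReal.inv_mul_cancel (by positivity) (by simp)

theorem integral_empiricalMeasure {Y : Type*} [MeasurableSpace Y] (S : Y → Y) (ℓ : ℕ) (y : Y)
    {f : Y → ℝ} (hf : StronglyMeasurable f) :
    ∫ x, f x ∂(empiricalMeasure S ℓ y) = (∑ i ∈ Finset.range ℓ, f (S^[i] y)) / ℓ := by
  rw [empiricalMeasure, integral_smul_measure, integral_finsetSum_measure]
  · simp [integral_dirac' _ _ hf, div_eq_inv_mul]
  · intro i _
    exact ⟨hf.aestronglyMeasurable, by simp [hasFiniteIntegral_def, lintegral_dirac' _ hf.enorm]⟩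

/-- Krylov–Bogolyubov: if a clopen set `E` has frequency at least `δ` in arbitrarily long orbit
segments, then some invariant probability measure gives it mass at least `δ`. -/
theorem exists_measurePreserving_le_measureReal {Y : Type*} [TopologicalSpace Y] [CompactSpace Y]
    [T2Space Y] [SecondCountableTopology Y] [HasOuterApproxClosed Y] [MeasurableSpace Y]
    [BorelSpace Y] {S : Y → Y}
    (hS : Continuous S) {E : Set Y} (hE : IsClopen E) {δ : ℝ}
    (h : ∀ L : ℕ, ∃ ℓ ≥ L, ∃ y : Y,
      δ * ℓ ≤ ∑ i ∈ Finset.range ℓ, E.indicator (fun _ => (1 : ℝ)) (S^[i] y)) :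
    ∃ μ : Measure Y, IsProbabilityMeasure μ ∧ MeasurePreserving S μ μ ∧ δ ≤ μ.real E := by
  -- Asking for length at least `L + 1` keeps every segment nonempty.
  choose ℓ hℓ y hy using fun L : ℕ => h (L + 1)
  have hpos : ∀ L, 0 < ℓ L := fun L => (Nat.succ_pos L).trans_le (hℓ L)
  let ν : ℕ → ProbabilityMeasure Y := fun L =>
    ⟨empiricalMeasure S (ℓ L) (y L), isProbabilityMeasure_empiricalMeasure S (hpos L) _⟩
  obtain ⟨μ, hμ⟩ := exists_tendsto_hyperfilter ν
  rw [ProbabilityMeasure.tendsto_iff_forall_integral_tendsto] at hμ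
  have hν : ∀ (f : BoundedContinuousFunction Y ℝ) (L : ℕ), ∫ x, f x ∂(ν L : Measure Y) =
      (∑ i ∈ Finset.range (ℓ L), f (S^[i] (y L))) / ℓ L := fun f L =>
    integral_empiricalMeasure S _ _ f.continuous.stronglyMeasurable
  have hℓtop : Tendsto (fun L => (ℓ L : ℝ)) atTop atTop :=
    tendsto_natCast_atTop_atTop.comp
      (tendsto_atTop_mono (fun L => (Nat.le_succ L).trans (hℓ L)) tendsto_id)
  refine ⟨μ, inferInstance, ⟨hS.measurable, ?_⟩, ?_⟩
  · have : IsProbabilityMeasure (Measure.map S (μ : Measure Y)) :=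
      Measure.isProbabilityMeasure_map hS.aemeasurable
    refine ext_of_forall_integral_eq_of_IsFiniteMeasure fun f => ?_
    rw [integral_map hS.aemeasurable f.continuous.stronglyMeasurable.aestronglyMeasurable]
    have h1 := hμ (f.compContinuous ⟨S, hS⟩)
    have h2 := hμ f
    have h3 : Tendsto (fun L => ∫ x, (f.compContinuous ⟨S, hS⟩) x ∂(ν L : Measure Y)
        - ∫ x, f x ∂(ν L : Measure Y)) (hyperfilter ℕ : Filter ℕ) (𝓝 0) := by
      refine Tendsto.mono_left ?_ Nat.hyperfilter_le_atTop
      refine squeeze_zero_norm (a := fun L => (2 * ‖f‖) / ℓ L) (fun L => ?_)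
        (tendsto_const_nhds.div_atTop hℓtop)
      rw [hν, hν, ← sub_div, ← Finset.sum_sub_distrib]
      -- The sum telescopes, so the defect of invariance is at most `2‖f‖ / ℓ`.
      have : ∑ i ∈ Finset.range (ℓ L), ((f.compContinuous ⟨S, hS⟩) (S^[i] (y L)) -
          f (S^[i] (y L))) = f (S^[ℓ L] (y L)) - f (y L) := by
        refine Eq.trans ?_ (Finset.sum_range_sub (fun i => f (S^[i] (y L))) _)
        simp [Function.iterate_succ_apply']
      rw [this, norm_div, Real.norm_natCast]
      gcongr
      calc _ ≤ ‖f (S^[ℓ L] (y L))‖ + ‖f (y L)‖ := norm_sub_le _ _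
        _ ≤ 2 * ‖f‖ := by linarith [f.norm_coe_le_norm (S^[ℓ L] (y L)), f.norm_coe_le_norm (y L)]
    exact sub_eq_zero.1 (tendsto_nhds_unique (h1.sub h2) h3)
  -- The indicator of a clopen set is continuous, so the lower bound passes to the weak limit.
  · let f : BoundedContinuousFunction Y ℝ := BoundedContinuousFunction.mkOfCompact
      ⟨E.indicator fun _ => 1, (continuous_const).indicator fun a ha => by simp [hE.frontier_eq] at ha⟩
    have h1 := hμ f
    have h2 : ∫ x, f x ∂(μ : Measure Y) = (μ : Measure Y).real E :=
      integral_indicator_one hE.isOpen.measurableSet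
    rw [← h2]
    refine ge_of_tendsto h1 (Eventually.of_forall fun L => ?_)
    rw [hν, le_div_iff₀ (by exact_mod_cast hpos L)]
    exact hy L

end TopDyn

/-! ### Herglotz's theorem via Fejér means -/

namespace TopDyn

open MeasureTheory ComplexConjugate ComplexOrder AddCircle

theorem integral_fourier_haarAddCircle (k : ℤ) :
    ∫ x : UnitAddCircle, fourier k x ∂haarAddCircle = if k = 0 then 1 else 0 := by
  split_ifs with h
  · simp [h]
  · exact integral_eq_zero_of_add_right_eq_neg (μ := haarAddCircle)
      (fourier_add_half_inv_index h one_pos)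

/-- The Fejér mean of order `N` of the trigonometric series with coefficients `φ`. -/
noncomputable def fejerMean (φ : ℤ → ℂ) (N : ℕ) (x : UnitAddCircle) : ℂ :=
  (N : ℂ)⁻¹ * ∑ m ∈ Finset.Ico (0 : ℤ) N, ∑ n ∈ Finset.Ico (0 : ℤ) N,
    φ (m - n) * fourier (n - m) x

theorem continuous_fejerMean (φ : ℤ → ℂ) (N : ℕ) : Continuous (fejerMean φ N) := by
  unfold fejerMean
  fun_prop

/-- The pairs with `m - n = k` form an interval of `m`. The linear error bound suffices for the
Fejér weights to tend to `1`, and at `k = 0` it gives exactly `N`. -/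
theorem card_pairs_sub_eq (N : ℕ) (k : ℤ) :
    |(∑ m ∈ Finset.Ico (0 : ℤ) N, ∑ n ∈ Finset.Ico (0 : ℤ) N,
      if k + (n - m) = 0 then (1 : ℝ) else 0) - N| ≤ |k| := by
  have h1 : ∀ m ∈ Finset.Ico (0 : ℤ) N, (∑ n ∈ Finset.Ico (0 : ℤ) N,
      if k + (n - m) = 0 then (1 : ℝ) else 0) =
      if m - k ∈ Finset.Ico (0 : ℤ) N then 1 else 0 := by
    intro m _
    rw [← Finset.sum_ite_eq' (Finset.Ico (0 : ℤ) N) (m - k) (fun _ => (1 : ℝ))]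
    refine Finset.sum_congr rfl fun n _ => ?_
    congr 1
    exact propext ⟨fun h => by linarith, fun h => by rw [h]; ring⟩
  rw [Finset.sum_congr rfl h1, Finset.sum_boole]
  have h2 : {m ∈ Finset.Ico (0 : ℤ) N | m - k ∈ Finset.Ico (0 : ℤ) N} =
      Finset.Ico (max 0 k) (min N (N + k)) := by
    ext m
    simp only [Finset.mem_filter, Finset.mem_Ico]
    omega
  rw [h2, Int.card_Ico]
  have h3 : |((min (N : ℤ) (N + k) - max 0 k).toNat : ℤ) - N| ≤ |k| := by
    rw [abs_le]
    rcases abs_cases k with h | h <;> omega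
  exact_mod_cast h3

theorem integral_fourier_mul_fejerMean (φ : ℤ → ℂ) (N : ℕ) (k : ℤ) :
    ∫ x, fourier k x * fejerMean φ N x ∂haarAddCircle =
      φ k * (((∑ m ∈ Finset.Ico (0 : ℤ) N, ∑ n ∈ Finset.Ico (0 : ℤ) N,
        if k + (n - m) = 0 then (1 : ℝ) else 0) / N : ℝ) : ℂ) := by
  have hint : ∀ f : UnitAddCircle → ℂ, Continuous f → Integrable f haarAddCircle :=
    fun f hf => hf.integrable_of_hasCompactSupport (HasCompactSupport.of_compactSpace f)
  have h1 : ∀ x, fourier k x * fejerMean φ N x = (N : ℂ)⁻¹ *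
      ∑ m ∈ Finset.Ico (0 : ℤ) N, ∑ n ∈ Finset.Ico (0 : ℤ) N,
        φ (m - n) * fourier (k + (n - m)) x := by
    intro x
    rw [fejerMean, mul_left_comm, Finset.mul_sum]
    congr 1
    refine Finset.sum_congr rfl fun m _ => ?_
    rw [Finset.mul_sum]
    refine Finset.sum_congr rfl fun n _ => ?_
    rw [fourier_add]
    ring
  simp_rw [h1]
  rw [integral_const_mul, integral_finsetSum _ fun m _ => hint _ (by fun_prop)]
  push_cast
  rw [div_eq_inv_mul, mul_left_comm]
  congr 1
  rw [Finset.mul_sum]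
  refine Finset.sum_congr rfl fun m _ => ?_
  rw [integral_finsetSum _ fun m _ => hint _ (by fun_prop), Finset.mul_sum]
  refine Finset.sum_congr rfl fun n _ => ?_
  rw [integral_const_mul, integral_fourier_haarAddCircle]
  split_ifs with h
  · rw [show m - n = k by linarith]
    simp
  · simp

/-- The double sum is the positive definite form evaluated at the characters `c m = fourier (-m) x`.
-/
theorem fejerMean_nonneg {φ : ℤ → ℂ}
    (hpos : ∀ (s : Finset ℤ) (c : ℤ → ℂ), 0 ≤ ∑ m ∈ s, ∑ n ∈ s, c m * conj (c n) * φ (m - n))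
    (N : ℕ) (x : UnitAddCircle) : 0 ≤ fejerMean φ N x := by
  have h := hpos (Finset.Ico (0 : ℤ) N) (fun m => fourier (-m) x)
  refine mul_nonneg (by simp) (h.trans_eq ?_)
  refine Finset.sum_congr rfl fun m _ => ?_
  refine Finset.sum_congr rfl fun n _ => ?_
  rw [← fourier_neg, neg_neg, ← fourier_add, mul_comm, neg_add_eq_sub]

/-- Herglotz's theorem: a normalised positive definite sequence is the sequence of Fourier
coefficients of a probability measure on the circle. -/
theorem exists_isProbabilityMeasure_integral_fourier_eq {φ : ℤ → ℂ} (h0 : φ 0 = 1)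
    (hpos : ∀ (s : Finset ℤ) (c : ℤ → ℂ), 0 ≤ ∑ m ∈ s, ∑ n ∈ s, c m * conj (c n) * φ (m - n)) :
    ∃ σ : Measure UnitAddCircle, IsProbabilityMeasure σ ∧ ∀ k, ∫ x, fourier k x ∂σ = φ k := by
  let ρ : ℕ → Measure UnitAddCircle := fun N =>
    haarAddCircle.withDensity fun x => ENNReal.ofReal (fejerMean φ (N + 1) x).re
  have hρ : ∀ N k, ∫ x, fourier k x ∂(ρ N) =
      φ k * (((∑ m ∈ Finset.Ico (0 : ℤ) (N + 1 : ℕ), ∑ n ∈ Finset.Ico (0 : ℤ) (N + 1 : ℕ),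
        if k + (n - m) = 0 then (1 : ℝ) else 0) / (N + 1 : ℕ) : ℝ) : ℂ) := by
    intro N k
    have hmeas : Measurable fun x => ENNReal.ofReal (fejerMean φ (N + 1) x).re :=
      ENNReal.measurable_ofReal.comp
        (Complex.continuous_re.comp (continuous_fejerMean φ _)).measurable
    rw [← integral_fourier_mul_fejerMean,
      integral_withDensity_eq_integral_toReal_smul hmeas (by simp)]
    refine integral_congr_ae (Eventually.of_forall fun x => ?_)
    have h := fejerMean_nonneg hpos (N + 1) x
    have h' : ((fejerMean φ (N + 1) x).re : ℂ) = fejerMean φ (N + 1) x :=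
      Complex.ext (by simp) (by simpa using (Complex.nonneg_iff.1 h).2)
    simp only [Complex.real_smul]
    rw [ENNReal.toReal_ofReal (Complex.nonneg_iff.1 h).1, h', mul_comm]
  have hρ1 : ∀ N, IsProbabilityMeasure (ρ N) := by
    intro N
    -- The zeroth coefficient is the total mass, and there the Fejér weight is exactly `1`.
    have h1 := hρ N 0
    have h2 := card_pairs_sub_eq (N + 1) 0
    rw [abs_zero, Int.cast_zero, abs_nonpos_iff, sub_eq_zero] at h2
    rw [h2, div_self (by positivity), h0] at h1
    simp only [fourier_zero, integral_const, Complex.real_smul, mul_one, Complex.ofReal_one] at h1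
    have h3 : (ρ N).real univ = 1 := by exact_mod_cast h1
    constructor
    rwa [Measure.real, ENNReal.toReal_eq_one_iff] at h3
  let ν : ℕ → ProbabilityMeasure UnitAddCircle := fun N => ⟨ρ N, hρ1 N⟩
  obtain ⟨σ, hσ⟩ := exists_tendsto_hyperfilter ν
  rw [ProbabilityMeasure.tendsto_iff_forall_integral_rclike_tendsto ℂ] at hσ
  refine ⟨σ, inferInstance, fun k => ?_⟩
  refine tendsto_nhds_unique (hσ (BoundedContinuousFunction.mkOfCompact (fourier k))) ?_
  refine Tendsto.mono_left ?_ Nat.hyperfilter_le_atTop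
  simp only [BoundedContinuousFunction.mkOfCompact_apply, ν, ProbabilityMeasure.coe_mk, hρ]
  have hN : Tendsto (fun N : ℕ => ((N + 1 : ℕ) : ℝ)) atTop atTop :=
    tendsto_natCast_atTop_atTop.comp (tendsto_add_atTop_nat 1)
  suffices hr : Tendsto (fun N : ℕ => (∑ m ∈ Finset.Ico (0 : ℤ) (N + 1 : ℕ),
      ∑ n ∈ Finset.Ico (0 : ℤ) (N + 1 : ℕ), if k + (n - m) = 0 then (1 : ℝ) else 0) /
      (N + 1 : ℕ)) atTop (𝓝 1) by
    simpa using (tendsto_const_nhds (x := φ k)).mul ((Complex.continuous_ofReal.tendsto 1).comp hr)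
  refine tendsto_iff_norm_sub_tendsto_zero.2 (squeeze_zero (fun _ => norm_nonneg _) (fun N => ?_)
    ((tendsto_const_nhds (x := |(k : ℝ)|)).div_atTop hN))
  have hne : ((N + 1 : ℕ) : ℝ) ≠ 0 := by positivity
  rw [div_sub_one hne, norm_div, Real.norm_natCast, Real.norm_eq_abs]
  exact div_le_div_of_nonneg_right
    ((card_pairs_sub_eq (N + 1) k).trans_eq Int.cast_abs) (by positivity)

end TopDyn

/-! ### Averages over long intervals, Wiener's lemma and Bohr sets -/

namespace TopDyn

open MeasureTheory ComplexConjugate AddCircle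

/-- The filter of pairs `(N, M)` of integers with `M - N → ∞`. -/
noncomputable def longIntervals : Filter (ℤ × ℤ) := comap (fun p : ℤ × ℤ => p.2 - p.1) atTop

instance : longIntervals.NeBot :=
  comap_neBot_iff.2 fun t ht => by
    obtain ⟨a, ha⟩ := (atTop_basis (α := ℤ)).mem_iff.1 ht
    exact ⟨(0, a), ha.2 (by simp)⟩

/-- Needed for dominated convergence along this filter. -/
instance : longIntervals.IsCountablyGenerated := by
  unfold longIntervals
  infer_instance

theorem eventually_longIntervals_le (k : ℤ) : ∀ᶠ p in longIntervals, k ≤ p.2 - p.1 :=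
  tendsto_comap.eventually (eventually_ge_atTop k)

theorem tendsto_length_longIntervals :
    Tendsto (fun p : ℤ × ℤ => (p.2 : ℝ) - p.1 + 1) longIntervals atTop := by
  have h : Tendsto (fun p : ℤ × ℤ => ((p.2 - p.1 : ℤ) : ℝ)) longIntervals atTop :=
    tendsto_intCast_atTop_atTop.comp tendsto_comap
  simpa using tendsto_atTop_add_const_right _ (1 : ℝ) h

theorem sum_Icc_int_eq_sum_range {M : Type*} [AddCommMonoid M] (f : ℤ → M) (a b : ℤ) :
    ∑ n ∈ Finset.Icc a b, f n = ∑ i ∈ Finset.range (b + 1 - a).toNat, f (a + i) := by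
  rw [Int.Icc_eq_finset_map, Finset.sum_map]
  simp

theorem exists_frequently_lt_of_upperBanachDensity_pos {A : Set ℤ}
    (h : 0 < upperBanachDensity A) : ∃ δ > 0, ∃ᶠ p : ℤ × ℤ in longIntervals,
      δ < ((A ∩ Icc p.1 p.2).ncard : ℝ) / ((p.2 : ℝ) - p.1 + 1) := by
  obtain ⟨δ, h0, hδ⟩ := exists_between h
  refine ⟨δ, h0, frequently_lt_of_lt_limsup ?_ hδ⟩
  -- Nonnegativity of the ratios gives the coboundedness required to use a real-valued limsup.
  refine isCoboundedUnder_le_of_eventually_le longIntervals (x := (0 : ℝ)) ?_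
  filter_upwards [eventually_longIntervals_le 0] with p hp
  have : (0 : ℝ) ≤ ((p.2 - p.1 : ℤ) : ℝ) := by exact_mod_cast hp
  push_cast at this
  positivity

/-- The geometric sum is bounded by `2 / ‖z - 1‖` wherever the interval starts. -/
theorem tendsto_average_zpow {z : ℂ} (hz : ‖z‖ = 1) (hz1 : z ≠ 1) :
    Tendsto (fun p : ℤ × ℤ => (∑ n ∈ Finset.Icc p.1 p.2, z ^ n) / ((p.2 : ℂ) - p.1 + 1))
      longIntervals (𝓝 0) := by
  have hz0 : z ≠ 0 := norm_pos_iff.1 (by simp [hz])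
  refine squeeze_zero_norm' ?_ ((tendsto_const_nhds (x := 2 / ‖z - 1‖)).div_atTop
    tendsto_length_longIntervals)
  filter_upwards [eventually_longIntervals_le 0] with p hp
  have hL : (0 : ℝ) ≤ (p.2 : ℝ) - p.1 + 1 := by
    have : (0 : ℝ) ≤ ((p.2 - p.1 : ℤ) : ℝ) := by exact_mod_cast hp
    push_cast at this
    linarith
  rw [norm_div, show (p.2 : ℂ) - p.1 + 1 = (((p.2 : ℝ) - p.1 + 1 : ℝ) : ℂ) by push_cast; rfl,
    Complex.norm_real, Real.norm_of_nonneg hL]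
  refine div_le_div_of_nonneg_right ?_ hL
  rw [sum_Icc_int_eq_sum_range]
  simp_rw [zpow_add₀ hz0, zpow_natCast]
  rw [← Finset.mul_sum, geom_sum_eq hz1, norm_mul, norm_div, norm_zpow, hz, one_zpow, one_mul]
  gcongr
  refine (norm_sub_le _ _).trans ?_
  simp [hz]
  norm_num

theorem fourier_eq_zpow (n : ℤ) (x : UnitAddCircle) : fourier n x = (fourier 1 x : ℂ) ^ n := by
  rw [fourier_apply, fourier_apply, one_zsmul, toCircle_zsmul, Circle.coe_zpow]

theorem fourier_one_ne_one {x : UnitAddCircle} (hx : x ≠ 0) : (fourier 1 x : ℂ) ≠ 1 := by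
  intro h
  refine hx (injective_toCircle one_ne_zero ?_)
  rw [toCircle_zero]
  exact Circle.ext (by simpa using h)

theorem fourier_sub (n : ℤ) (x y : UnitAddCircle) :
    (fourier n (x - y) : ℂ) = fourier n x * conj (fourier n y : ℂ) := by
  rw [← fourier_neg, fourier_apply, fourier_apply, fourier_apply, zsmul_sub, sub_eq_add_neg,
    toCircle_add, neg_smul, Circle.coe_mul]

theorem norm_fourier_apply (n : ℤ) (x : UnitAddCircle) : ‖(fourier n x : ℂ)‖ = 1 := by
  rw [fourier_apply, Circle.norm_coe]

theorem integrable_fourier (μ : Measure UnitAddCircle) [IsFiniteMeasure μ] (n : ℤ) :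
    Integrable (fun x => (fourier n x : ℂ)) μ :=
  Integrable.of_bound (map_continuous _).aestronglyMeasurable 1
    (Eventually.of_forall fun x => (norm_fourier_apply n x).le)

/-- Wiener's lemma: the Fourier coefficients of a continuous measure tend to `0` in quadratic mean
along arbitrary long intervals. -/
theorem tendsto_average_norm_integral_fourier_sq (σ : Measure UnitAddCircle) [IsFiniteMeasure σ]
    [NullSingletonClass σ] :
    Tendsto (fun p : ℤ × ℤ =>
      (∑ n ∈ Finset.Icc p.1 p.2, ‖∫ x, (fourier n x : ℂ) ∂σ‖ ^ 2) / ((p.2 : ℝ) - p.1 + 1))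
      longIntervals (𝓝 0) := by
  have hcont : ∀ n : ℤ, Continuous fun z : UnitAddCircle × UnitAddCircle =>
      (fourier n (z.1 - z.2) : ℂ) := fun n => by fun_prop
  -- By Fubini the squared coefficient integrates a character of `x - y`. The averages of these
  -- characters vanish in the limit off the diagonal, which is null because `σ` has no atoms.
  have hsq : ∀ n : ℤ, ((‖∫ x, (fourier n x : ℂ) ∂σ‖ ^ 2 : ℝ) : ℂ) =
      ∫ z, (fourier n (z.1 - z.2) : ℂ) ∂(σ.prod σ) := by
    intro n
    simp_rw [fourier_sub]
    rw [integral_prod_mul (fun x => (fourier n x : ℂ)) fun y => conj (fourier n y : ℂ),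
      integral_conj, Complex.mul_conj, Complex.normSq_eq_norm_sq]
  have hdiag : ∀ᵐ z ∂(σ.prod σ), z.1 - z.2 ≠ 0 := by
    have hm : MeasurableSet {z : UnitAddCircle × UnitAddCircle | z.1 - z.2 = 0} :=
      (isClosed_eq (by fun_prop) continuous_const).measurableSet
    rw [ae_iff]
    simp only [ne_eq, not_not]
    rw [Measure.measure_prod_null hm]
    refine Eventually.of_forall fun x => ?_
    have : Prod.mk x ⁻¹' {z : UnitAddCircle × UnitAddCircle | z.1 - z.2 = 0} = {x} := by
      ext y
      simp [sub_eq_zero, eq_comm]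
    simp [this]
  have key : Tendsto (fun p : ℤ × ℤ => ∫ z, (∑ n ∈ Finset.Icc p.1 p.2,
      (fourier n (z.1 - z.2) : ℂ)) / ((p.2 : ℂ) - p.1 + 1) ∂(σ.prod σ)) longIntervals
      (𝓝 (∫ _, (0 : ℂ) ∂(σ.prod σ))) := by
    refine tendsto_integral_filter_of_dominated_convergence (fun _ => 1) ?_ ?_
      (integrable_const 1) ?_
    · refine Eventually.of_forall fun p => Continuous.aestronglyMeasurable ?_
      exact (continuous_finsetSum _ fun n _ => hcont n).div_const _
    · filter_upwards [eventually_longIntervals_le 0] with p hp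
      refine Eventually.of_forall fun z => ?_
      have hL : (0 : ℝ) < (p.2 : ℝ) - p.1 + 1 := by
        have : (0 : ℝ) ≤ ((p.2 - p.1 : ℤ) : ℝ) := by exact_mod_cast hp
        push_cast at this
        linarith
      rw [norm_div, show (p.2 : ℂ) - p.1 + 1 = (((p.2 : ℝ) - p.1 + 1 : ℝ) : ℂ) by push_cast; rfl,
        Complex.norm_real, Real.norm_of_nonneg hL.le, div_le_one hL]
      refine (norm_sum_le _ _).trans ?_
      simp only [norm_fourier_apply, Finset.sum_const, Int.card_Icc, nsmul_eq_mul, mul_one]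
      have : (((p.2 + 1 - p.1).toNat : ℤ) : ℝ) = ((p.2 + 1 - p.1 : ℤ) : ℝ) := by
        rw [Int.toNat_of_nonneg (by linarith)]
      push_cast at this
      linarith
    · filter_upwards [hdiag] with z hz
      refine (tendsto_average_zpow (norm_fourier_apply 1 _) (fourier_one_ne_one hz)).congr
        fun p => ?_
      rw [Finset.sum_congr rfl fun n _ => fourier_eq_zpow n (z.1 - z.2)]
  rw [integral_zero] at key
  have := (Complex.continuous_re.tendsto _).comp key
  rw [Complex.zero_re] at this
  refine this.congr fun p => ?_
  rw [Function.comp_apply, integral_div, integral_finsetSum]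
  · simp_rw [← hsq]
    rw [← Complex.ofReal_sum, show (p.2 : ℂ) - p.1 + 1 = (((p.2 : ℝ) - p.1 + 1 : ℝ) : ℂ) by
      push_cast; rfl, ← Complex.ofReal_div, Complex.ofReal_re]
  · intro n _
    exact Integrable.of_bound (hcont n).aestronglyMeasurable 1
      (Eventually.of_forall fun z => (norm_fourier_apply _ _).le)

theorem isBohrSet_fourier_re_pos (F : Set UnitAddCircle) (hF : F.Finite) :
    IsBohrSet {n : ℤ | ∀ x ∈ F, 0 < (fourier n x : ℂ).re} := by
  obtain ⟨m, f, hf⟩ := hF.fin_param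
  refine ⟨m, fun i => toCircle (f i), {z | ∀ i, 0 < (z i : ℂ).re}, ?_, ⟨0, by simp⟩, ?_⟩
  · simp only [ofPred_forall]
    exact isOpen_iInter_of_finite fun i => isOpen_lt continuous_const
      (Complex.continuous_re.comp (continuous_subtype_val.comp (continuous_apply i)))
  · rintro n hn x hx
    rw [← hf.2] at hx
    obtain ⟨i, rfl⟩ := hx
    have := hn i
    rwa [Pi.pow_apply, ← toCircle_zsmul, ← fourier_apply] at this

theorem exists_finite_measure_diff_lt {α : Type*} [MeasurableSpace α] [MeasurableSingletonClass α]
    (σ : Measure α) [IsFiniteMeasure σ] {D : Set α} (hD : D.Countable) {ε : ℝ} (hε : 0 < ε) :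
    ∃ F ⊆ D, F.Finite ∧ σ.real (D \ F) < ε := by
  rcases D.eq_empty_or_nonempty with rfl | hne
  · exact ⟨∅, by simp, by simp, by simpa⟩
  obtain ⟨f, rfl⟩ := hD.exists_eq_range hne
  have h : Tendsto (fun k : ℕ => σ (range f \ f '' Iio k)) atTop
      (𝓝 (σ (⋂ k : ℕ, range f \ f '' Iio k))) := by
    refine tendsto_measure_iInter_atTop (fun k => ?_) (fun i j hij => ?_) ⟨0, by simp⟩
    · exact (hD.mono sdiff_subset).measurableSet.nullMeasurableSet
    · exact sdiff_subset_sdiff_right (image_mono (Iio_subset_Iio hij))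
  have hempty : ⋂ k : ℕ, range f \ f '' Iio k = ∅ := by
    refine eq_empty_of_forall_notMem fun x hx => ?_
    rw [mem_iInter] at hx
    obtain ⟨i, rfl⟩ := (hx 0).1
    exact (hx (i + 1)).2 ⟨i, by simp, rfl⟩
  rw [hempty, measure_empty] at h
  have h' := (ENNReal.tendsto_toReal ENNReal.zero_ne_top).comp h
  obtain ⟨k, hk⟩ := (h'.eventually (gt_mem_nhds hε)).exists
  exact ⟨f '' Iio k, image_subset_range _ _, (finite_Iio k).image f, hk⟩

theorem countable_setOf_measure_singleton_pos {α : Type*} [MeasurableSpace α]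
    [MeasurableSingletonClass α] (σ : Measure α) [IsFiniteMeasure σ] :
    {x | 0 < σ {x}}.Countable :=
  Measure.countable_meas_pos_of_disjoint_iUnion (μ := σ) (As := fun x => {x})
    (fun x => measurableSet_singleton x) fun _ _ h => disjoint_singleton.2 h

/-- On a suitable Bohr set, the Fourier coefficients of a finite measure have real part at most
`-b` only on sets of upper Banach density zero. -/
theorem exists_isBohrSet_integral_fourier (σ : Measure UnitAddCircle) [IsFiniteMeasure σ] {b : ℝ}
    (hb : 0 < b) : ∃ B, IsBohrSet B ∧ ∀ Q ⊆ B,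
      (∀ n ∈ Q, (∫ x, (fourier n x : ℂ) ∂σ).re ≤ -b) → ¬ 0 < upperBanachDensity Q := by
  set D := {x | 0 < σ {x}} with hDdef
  have hD : D.Countable := countable_setOf_measure_singleton_pos σ
  -- `F` carries all the atomic mass but less than `b / 2`; the Bohr set makes its contribution have
  -- nonnegative real part.
  obtain ⟨F, hFD, hF, hlt⟩ := exists_finite_measure_diff_lt σ hD (half_pos hb)
  refine ⟨_, isBohrSet_fourier_re_pos F hF, fun Q hQ hQb hpos => ?_⟩
  have hnull : NullSingletonClass (σ.restrict Dᶜ) := by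
    constructor
    intro x
    rw [Measure.restrict_apply (measurableSet_singleton x)]
    by_cases hx : 0 < σ {x}
    · have : ({x} ∩ Dᶜ : Set UnitAddCircle) = ∅ := by
        rw [singleton_inter_eq_empty]
        exact fun h => h hx
      simp [this]
    · exact measure_mono_null inter_subset_left (by simpa using hx)
  -- A total real part at most `-b`, with at least `0` from `F` and more than `-b / 2` from the
  -- other atoms, leaves at most `-b / 2` for the continuous part. Wiener's lemma forbids this on
  -- positive density.
  have hQc : ∀ n ∈ Q, (b / 2) ^ 2 ≤ ‖∫ x, (fourier n x : ℂ) ∂(σ.restrict Dᶜ)‖ ^ 2 := by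
    intro n hn
    have hi := integrable_fourier σ n
    have h1 : (∫ x, (fourier n x : ℂ) ∂σ) = ∫ x in F, (fourier n x : ℂ) ∂σ +
        ∫ x in D \ F, (fourier n x : ℂ) ∂σ + ∫ x in Dᶜ, (fourier n x : ℂ) ∂σ := by
      rw [← integral_add_compl hD.measurableSet hi,
        ← setIntegral_union disjoint_sdiff_right (hD.mono sdiff_subset).measurableSet
          hi.integrableOn hi.integrableOn, union_sdiff_cancel hFD]
    have h2 : 0 ≤ (∫ x in F, (fourier n x : ℂ) ∂σ).re := by
      have := integral_re (𝕜 := ℂ) (hi.integrableOn (s := F))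
      simp only [RCLike.re_eq_complex_re] at this
      rw [← this]
      exact setIntegral_nonneg hF.measurableSet fun x hx => (hQ hn x hx).le
    have h3 : ‖∫ x in D \ F, (fourier n x : ℂ) ∂σ‖ ≤ 1 * σ.real (D \ F) :=
      norm_setIntegral_le_of_norm_le_const (measure_lt_top _ _) fun x _ =>
        (norm_fourier_apply n x).le
    have h4 := hQb n hn
    rw [h1, Complex.add_re, Complex.add_re] at h4
    have h5 := (abs_le.1 (Complex.abs_re_le_norm (∫ x in D \ F, (fourier n x : ℂ) ∂σ))).1
    have h6 := (abs_le.1 (Complex.abs_re_le_norm (∫ x in Dᶜ, (fourier n x : ℂ) ∂σ))).1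
    gcongr
    linarith
  obtain ⟨δ, hδ, hfreq⟩ := exists_frequently_lt_of_upperBanachDensity_pos hpos
  have hlim := (tendsto_average_norm_integral_fourier_sq (σ.restrict Dᶜ)).eventually
    (gt_mem_nhds (show 0 < δ * (b / 2) ^ 2 by positivity))
  obtain ⟨p, hp1, hp2, hp3⟩ := (hfreq.and_eventually
    (hlim.and (eventually_longIntervals_le 0))).exists
  have hL : (0 : ℝ) < (p.2 : ℝ) - p.1 + 1 := by
    have : (0 : ℝ) ≤ ((p.2 - p.1 : ℤ) : ℝ) := by exact_mod_cast hp3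
    push_cast at this
    linarith
  classical
  have hcard : (Q ∩ Icc p.1 p.2).ncard = {n ∈ Finset.Icc p.1 p.2 | n ∈ Q}.card := by
    rw [← Set.ncard_coe_finset]
    congr 1
    ext n
    simp [and_comm]
  have hsum : ((Q ∩ Icc p.1 p.2).ncard : ℝ) * (b / 2) ^ 2 ≤
      ∑ n ∈ Finset.Icc p.1 p.2, ‖∫ x, (fourier n x : ℂ) ∂(σ.restrict Dᶜ)‖ ^ 2 := by
    rw [hcard, ← nsmul_eq_mul]
    refine (Finset.card_nsmul_le_sum _ _ _ fun n hn =>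
      hQc n (Finset.mem_filter.1 hn).2).trans ?_
    exact Finset.sum_le_sum_of_subset_of_nonneg (Finset.filter_subset _ _)
      fun _ _ _ => sq_nonneg _
  rw [lt_div_iff₀ hL] at hp1
  rw [div_lt_iff₀ hL] at hp2
  nlinarith [mul_lt_mul_of_pos_right hp1 (show 0 < (b / 2) ^ 2 by positivity)]

end TopDyn

/-! ### Følner's theorem for stationary events -/

namespace TopDyn

open MeasureTheory ComplexConjugate ComplexOrder

theorem integral_centered_indicator_mul {Y : Type*} [MeasurableSpace Y] (μ : Measure Y)
    [IsProbabilityMeasure μ] {C D : Set Y} (hC : MeasurableSet C) (hD : MeasurableSet D) {p : ℝ}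
    (hCp : μ.real C = p) (hDp : μ.real D = p) :
    ∫ y, (C.indicator (fun _ => (1 : ℝ)) y - p) * (D.indicator (fun _ => (1 : ℝ)) y - p) ∂μ =
      μ.real (C ∩ D) - p ^ 2 := by
  have hint : ∀ {E : Set Y}, MeasurableSet E → Integrable (E.indicator fun _ => (1 : ℝ)) μ :=
    fun hE => (integrable_const 1).indicator hE
  have h : ∀ y, (C.indicator (fun _ => (1 : ℝ)) y - p) * (D.indicator (fun _ => (1 : ℝ)) y - p) =
      (C ∩ D).indicator (fun _ => (1 : ℝ)) y - p * C.indicator (fun _ => (1 : ℝ)) y -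
        p * D.indicator (fun _ => (1 : ℝ)) y + p ^ 2 := by
    intro y
    by_cases h1 : y ∈ C <;> by_cases h2 : y ∈ D <;> simp [h1, h2] <;> ring
  simp_rw [h]
  have hCD := hint (hC.inter hD)
  have hC' := (hint hC).const_mul p
  have hD' := (hint hD).const_mul p
  have h1 : Integrable (fun y => (C ∩ D).indicator (fun _ => (1 : ℝ)) y -
    p * C.indicator (fun _ => (1 : ℝ)) y) μ := hCD.sub hC'
  have h2 : Integrable (fun y => (C ∩ D).indicator (fun _ => (1 : ℝ)) y -
    p * C.indicator (fun _ => (1 : ℝ)) y - p * D.indicator (fun _ => (1 : ℝ)) y) μ := h1.sub hD'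
  rw [integral_add h2 (integrable_const _), integral_sub h1 hD', integral_sub hCD hC', integral_const_mul, integral_const_mul,
    integral_const]
  have hind : ∀ {E : Set Y}, MeasurableSet E →
      ∫ y, E.indicator (fun _ => (1 : ℝ)) y ∂μ = μ.real E := fun hE => integral_indicator_one hE
  rw [hind hC, hind hD, hind (hC.inter hD), hCp, hDp]
  simp
  ring

/-- The autocovariance of a stationary sequence of events is positive definite. -/
theorem sum_mul_conj_mul_covariance_nonneg {Y : Type*} [MeasurableSpace Y] (μ : Measure Y)
    [IsProbabilityMeasure μ] {C : ℤ → Set Y} (hC : ∀ n, MeasurableSet (C n)) {φ : ℤ → ℝ}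
    (hφ : ∀ m n, μ.real (C m ∩ C n) = φ (m - n)) (s : Finset ℤ) (c : ℤ → ℂ) :
    0 ≤ ∑ m ∈ s, ∑ n ∈ s, c m * conj (c n) * ((φ (m - n) - φ 0 ^ 2 : ℝ) : ℂ) := by
  have hp : ∀ n, μ.real (C n) = φ 0 := fun n => by simpa using hφ n n
  let h : ℤ → Y → ℝ := fun n y => (C n).indicator (fun _ => (1 : ℝ)) y - φ 0
  have hint : ∀ m n, Integrable (fun y => h m y * h n y) μ := by
    intro m n
    have hm : ∀ k, Measurable (h k) := fun k =>
      (measurable_const.indicator (hC k)).sub_const _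
    have hb : ∀ k y, ‖h k y‖ ≤ 1 + |φ 0| := fun k y => by
      refine (norm_sub_le _ _).trans (add_le_add ?_ le_rfl)
      by_cases hy : y ∈ C k <;> simp [hy]
    refine Integrable.of_bound ((hm m).mul (hm n)).aestronglyMeasurable
      ((1 + |φ 0|) * (1 + |φ 0|)) (Eventually.of_forall fun y => ?_)
    rw [norm_mul]
    exact mul_le_mul (hb m y) (hb n y) (norm_nonneg _) (by positivity)
  -- The form is the mean square of a combination of centred indicators.
  have key : ∑ m ∈ s, ∑ n ∈ s, c m * conj (c n) * ((φ (m - n) - φ 0 ^ 2 : ℝ) : ℂ) =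
      ∫ y, ((Complex.normSq (∑ m ∈ s, c m * (h m y : ℂ)) : ℝ) : ℂ) ∂μ := by
    have hexp : ∀ y, ((Complex.normSq (∑ m ∈ s, c m * (h m y : ℂ)) : ℝ) : ℂ) =
        ∑ m ∈ s, ∑ n ∈ s, c m * conj (c n) * ((h m y * h n y : ℝ) : ℂ) := by
      intro y
      rw [← Complex.mul_conj, map_sum, Finset.sum_mul_sum]
      refine Finset.sum_congr rfl fun m _ => ?_
      refine Finset.sum_congr rfl fun n _ => ?_
      simp only [map_mul, Complex.conj_ofReal, Complex.ofReal_mul]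
      ring
    simp_rw [hexp]
    rw [integral_finsetSum _ fun m _ => integrable_finsetSum _ fun n _ =>
      ((hint m n).ofReal).const_mul _]
    refine Finset.sum_congr rfl fun m _ => ?_
    rw [integral_finsetSum _ fun n _ => ((hint m n).ofReal).const_mul _]
    refine Finset.sum_congr rfl fun n _ => ?_
    rw [integral_const_mul, integral_complex_ofReal,
      integral_centered_indicator_mul μ (hC m) (hC n) (hp m) (hp n), hφ]
  rw [key, integral_complex_ofReal]
  exact Complex.zero_le_real.2 (integral_nonneg fun y => Complex.normSq_nonneg _)

/-- Følner's theorem: the return times of a set of positive measure contain a Bohr set up to a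
set of upper Banach density zero. -/
theorem exists_isBohrSet_of_stationary {Y : Type*} [MeasurableSpace Y] (μ : Measure Y)
    [IsProbabilityMeasure μ] {C : ℤ → Set Y} (hC : ∀ n, MeasurableSet (C n)) {φ : ℤ → ℝ}
    (hφ : ∀ m n, μ.real (C m ∩ C n) = φ (m - n)) (h0 : 0 < φ 0) :
    ∃ B, IsBohrSet B ∧ ∀ Q ⊆ B, (∀ n ∈ Q, φ n = 0) → ¬ 0 < upperBanachDensity Q := by
  set p := φ 0 with hp
  have hp1 : p ≤ 1 := by
    have := hφ 0 0
    rw [sub_self, ← hp] at this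
    rw [← this]
    exact measureReal_le_one
  have hd : 0 < p - p ^ 2 / 2 := by nlinarith
  -- Only half of `p ^ 2` is subtracted: `φ - p ^ 2 / 2` is the covariance plus a positive constant,
  -- hence still positive definite, while zeros of `φ` become strictly negative coefficients.
  let ψ : ℤ → ℂ := fun n => (((φ n - p ^ 2 / 2) / (p - p ^ 2 / 2) : ℝ) : ℂ)
  have hψ0 : ψ 0 = 1 := by
    simp only [ψ, ← hp]
    rw [div_self hd.ne', Complex.ofReal_one]
  have hψ : ∀ (s : Finset ℤ) (c : ℤ → ℂ),
      0 ≤ ∑ m ∈ s, ∑ n ∈ s, c m * conj (c n) * ψ (m - n) := by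
    intro s c
    have h1 := sum_mul_conj_mul_covariance_nonneg μ hC hφ s c
    have h2 : (0 : ℂ) ≤ ((Complex.normSq (∑ m ∈ s, c m) * (p ^ 2 / 2) : ℝ) : ℂ) :=
      Complex.zero_le_real.2 (mul_nonneg (Complex.normSq_nonneg _) (by positivity))
    have h3 : (0 : ℂ) ≤ (((p - p ^ 2 / 2)⁻¹ : ℝ) : ℂ) :=
      Complex.zero_le_real.2 (inv_nonneg.2 hd.le)
    refine (mul_nonneg h3 (add_nonneg h1 h2)).trans_eq ?_
    rw [Complex.ofReal_mul, ← Complex.mul_conj, map_sum, Finset.sum_mul_sum, Finset.sum_mul,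
      ← Finset.sum_add_distrib, Finset.mul_sum]
    refine Finset.sum_congr rfl fun m _ => ?_
    rw [Finset.sum_mul, ← Finset.sum_add_distrib, Finset.mul_sum]
    refine Finset.sum_congr rfl fun n _ => ?_
    rw [← hp, ← mul_add, ← Complex.ofReal_add, mul_left_comm, ← Complex.ofReal_mul]
    congr 2
    rw [div_eq_inv_mul]
    ring
  obtain ⟨σ, hσ1, hσ⟩ := exists_isProbabilityMeasure_integral_fourier_eq hψ0 hψ
  obtain ⟨B, hB, h⟩ := exists_isBohrSet_integral_fourier σ
    (show 0 < (p ^ 2 / 2) / (p - p ^ 2 / 2) by positivity)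
  refine ⟨B, hB, fun Q hQ hQ0 => h Q hQ fun n hn => ?_⟩
  rw [hσ, Complex.ofReal_re, hQ0 n hn, zero_sub, neg_div]

end TopDyn

/-! ### The compact shift of covering itineraries -/

namespace TopDyn

open MeasureTheory

theorem exists_subset_encard_le_of_coverNumber_le {X : Type*} {𝒰 : Set (Set X)} {k : ℕ}
    (h : coverNumber 𝒰 ≤ k) : ∃ 𝒱 ⊆ 𝒰, ⋃₀ 𝒱 = univ ∧ 𝒱.encard ≤ k := by
  have hlt : coverNumber 𝒰 < (k + 1 : ℕ) := h.trans_lt (by exact_mod_cast k.lt_succ_self)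
  obtain ⟨_, ⟨𝒱, h1, h2, rfl⟩, h3⟩ := sInf_lt_iff.1 hlt
  exact ⟨𝒱, h1, h2, by simpa using ENat.lt_add_one_iff (ENat.natCast_ne_top k) |>.1 h3⟩

theorem exists_fin_range_eq_of_encard_le {α : Type*} {s : Set α} (hs : s.Nonempty) {k : ℕ}
    (h : s.encard ≤ k) : ∃ f : Fin k → α, range f = s := by
  have hfin : s.Finite := finite_of_encard_le_coe h
  have := hfin.fintype
  have := hs.to_subtype
  obtain ⟨e⟩ := Function.Embedding.nonempty_of_card_le (α := s) (β := Fin k) (by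
    rw [Fintype.card_fin, ← Nat.card_eq_fintype_card, Nat.card_coe_set_eq]
    exact_mod_cast hfin.cast_ncard_eq.trans_le h)
  refine ⟨fun i => (Function.invFun e i : s), ?_⟩
  rw [range_comp' Subtype.val, (Function.invFun_surjective e.injective).range_eq]
  simp

variable {X : Type*} [TopologicalSpace X]

theorem zpow_add_apply (T : X ≃ₜ X) (m n : ℤ) (x : X) :
    (T ^ (m + n) : X ≃ₜ X) x = (T ^ m : X ≃ₜ X) ((T ^ n : X ≃ₜ X) x) := by
  rw [zpow_add]
  rfl

/-- The points whose orbit respects the `j`-th itinerary recorded in `y`: at each time `n` marked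
by `y`, the point `Tⁿ x` lies in the member of `F` prescribed by `y`. -/
def itinerarySet (T : X ≃ₜ X) {r K : ℕ} (F : Fin r → Set X)
    (y : ℤ → Bool × (Fin K → Fin r)) (j : Fin K) : Set X :=
  {x | ∀ n : ℤ, (y n).1 = true → (T ^ n : X ≃ₜ X) x ∈ F ((y n).2 j)}

/-- The families of `K` itineraries, along a marked set of times, that cover the space. -/
def coveringCodes (T : X ≃ₜ X) {r : ℕ} (K : ℕ) (F : Fin r → Set X) :
    Set (ℤ → Bool × (Fin K → Fin r)) :=
  {y | ∀ x, ∃ j, x ∈ itinerarySet T F y j}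

variable (T : X ≃ₜ X) {r K : ℕ} (F : Fin r → Set X)

theorem isClosed_itinerarySet (hF : ∀ i, IsClosed (F i)) (y : ℤ → Bool × (Fin K → Fin r))
    (j : Fin K) : IsClosed (itinerarySet T F y j) := by
  simp only [itinerarySet, ofPred_forall]
  exact isClosed_iInter fun n => isClosed_iInter fun _ => (hF _).preimage (T ^ n).continuous

theorem isClosed_setOf_mem_itinerarySet (x : X) (j : Fin K) :
    IsClosed {y : ℤ → Bool × (Fin K → Fin r) | x ∈ itinerarySet T F y j} := by
  have h : {y : ℤ → Bool × (Fin K → Fin r) | x ∈ itinerarySet T F y j} =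
      ⋂ n : ℤ, {y | (y n).1 = true → (T ^ n : X ≃ₜ X) x ∈ F ((y n).2 j)} := by
    ext y
    simp [itinerarySet]
  rw [h]
  refine isClosed_iInter fun n => ?_
  exact (isClosed_discrete {c : Bool × (Fin K → Fin r) |
    c.1 = true → (T ^ n : X ≃ₜ X) x ∈ F (c.2 j)}).preimage
      (f := fun y : ℤ → Bool × (Fin K → Fin r) => y n) (continuous_apply n)

/-- The union over `j` is finite since `K` is fixed; this is what makes the code space compact. -/
theorem isClosed_coveringCodes : IsClosed (coveringCodes T K F) := by
  simp only [coveringCodes, ofPred_forall, ofPred_exists]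
  exact isClosed_iInter fun x => isClosed_iUnion_of_finite fun j =>
    isClosed_setOf_mem_itinerarySet T F x j

theorem mem_itinerarySet_shift {y : ℤ → Bool × (Fin K → Fin r)} {j : Fin K} {k : ℤ} {x : X} :
    x ∈ itinerarySet T F (fun n => y (n + k)) j ↔
      (T ^ (-k) : X ≃ₜ X) x ∈ itinerarySet T F y j := by
  constructor
  · intro h n hn
    rw [← zpow_add_apply, ← sub_eq_add_neg]
    simpa using h (n - k) (by simpa using hn)
  · intro h n hn
    have := h (n + k) hn
    rwa [← zpow_add_apply, add_neg_cancel_right] at this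

/-- The shift by `k` on covering families of itineraries. -/
def shiftCode (k : ℤ) (y : coveringCodes T K F) : coveringCodes T K F :=
  ⟨fun n => y.1 (n + k), fun x => by
    obtain ⟨j, hj⟩ := y.2 ((T ^ (-k) : X ≃ₜ X) x)
    exact ⟨j, (mem_itinerarySet_shift T F).2 hj⟩⟩

theorem continuous_coveringCodes_apply (n : ℤ) :
    Continuous fun y : coveringCodes T K F => y.1 n :=
  (continuous_apply n).comp continuous_subtype_val

theorem continuous_shiftCode (k : ℤ) : Continuous (shiftCode T F (K := K) k) :=
  Continuous.subtype_mk (f := fun (y : coveringCodes T K F) n => y.1 (n + k))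
    (continuous_pi fun n => continuous_coveringCodes_apply T F (n + k)) _

theorem shiftCode_shiftCode (k l : ℤ) (y : coveringCodes T K F) :
    shiftCode T F k (shiftCode T F l y) = shiftCode T F (k + l) y :=
  Subtype.ext (funext fun n => by simp [shiftCode, add_assoc])

theorem shiftCode_zero (y : coveringCodes T K F) : shiftCode T F 0 y = y :=
  Subtype.ext (funext fun n => by simp [shiftCode])

theorem iterate_shiftCode (i : ℕ) (y : coveringCodes T K F) :
    (shiftCode T F 1)^[i] y = shiftCode T F i y := by
  induction i with
  | zero => simp [shiftCode_zero]
  | succ i ih =>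
    rw [Function.iterate_succ_apply', ih, shiftCode_shiftCode, add_comm]
    push_cast
    rfl

theorem measurePreserving_shiftCode {μ : Measure (coveringCodes T K F)}
    (h : MeasurePreserving (shiftCode T F 1) μ μ) (k : ℤ) :
    MeasurePreserving (shiftCode T F k) μ μ := by
  have hnat : ∀ i : ℕ, MeasurePreserving (shiftCode T F i) μ μ := fun i => by
    have := h.iterate i
    rwa [funext (iterate_shiftCode T F i)] at this
  have hm : ∀ k, Measurable (shiftCode T F (K := K) k) := fun k =>
    (continuous_shiftCode T F k).measurable
  obtain ⟨i, rfl | rfl⟩ := k.eq_nat_or_neg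
  · exact hnat i
  · refine ⟨hm _, ?_⟩
    conv_lhs => rw [← (hnat i).map_eq]
    rw [Measure.map_map (hm _) (hm _)]
    have : shiftCode T F (-(i : ℤ)) ∘ shiftCode T F (K := K) i = id := funext fun y => by
      simp [shiftCode_shiftCode, shiftCode_zero]
    rw [this, Measure.map_id]

/-- The codes all of whose points in `V` follow the `j`-th itinerary, which is at `F u` at the
marked time `0`. -/
def cylinder (V : Set X) (j : Fin K) (u : Fin r) : Set (coveringCodes T K F) :=
  {y | (∀ x ∈ V, x ∈ itinerarySet T F y.1 j) ∧ (y.1 0).1 = true ∧ (y.1 0).2 j = u}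

theorem isClosed_cylinder (V : Set X) (j : Fin K) (u : Fin r) :
    IsClosed (cylinder T F V j u) := by
  have h1 : IsClosed {y : coveringCodes T K F | ∀ x ∈ V, x ∈ itinerarySet T F y.1 j} := by
    simp only [ofPred_forall]
    exact isClosed_iInter fun x => isClosed_iInter fun _ =>
      (isClosed_setOf_mem_itinerarySet T F x j).preimage continuous_subtype_val
  have h2 : IsClosed {y : coveringCodes T K F | (y.1 0).1 = true ∧ (y.1 0).2 j = u} :=
    (isClosed_discrete {c : Bool × (Fin K → Fin r) | c.1 = true ∧ c.2 j = u}).preimage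
      (continuous_coveringCodes_apply T F 0)
  exact h1.inter h2

/-- The code `y` makes `V` follow itinerary `j`, and membership of its shift says that this
itinerary prescribes `F u` at the marked time `n`; so `T^n V ⊆ F u`. -/
theorem returnTimes_subset_of_cylinder {V : Set X} {j : Fin K} {u : Fin r} {n : ℤ}
    {y : coveringCodes T K F} (h0 : y ∈ cylinder T F V j u)
    (hn : shiftCode T F n y ∈ cylinder T F V j u) : n ∉ returnTimes T V (F u)ᶜ := by
  rintro ⟨_, ⟨x, hx, rfl⟩, hxu⟩
  have h1 : (y.1 n).1 = true ∧ (y.1 n).2 j = u := by simpa [shiftCode] using hn.2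
  refine hxu ?_
  rw [← h1.2]
  exact h0.1 x hx n h1.1

/-- Codes covering the space that are marked along a set of positive upper Banach density carry
an invariant measure charging the codes marked at time `0`. -/
theorem exists_measurePreserving_shiftCode {A : Set ℤ} (hA : 0 < upperBanachDensity A)
    (hcov : ∀ s : Finset ℤ, ∃ t : ℤ → Fin K → Fin r, ∀ x, ∃ j, ∀ n ∈ s, n ∈ A →
      (T ^ n : X ≃ₜ X) x ∈ F (t n j)) :
    ∃ μ : Measure (coveringCodes T K F), IsProbabilityMeasure μ ∧
      MeasurePreserving (shiftCode T F 1) μ μ ∧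
      0 < μ.real {y : coveringCodes T K F | (y.1 0).1 = true} := by
  classical
  have : CompactSpace (coveringCodes T K F) :=
    isCompact_iff_compactSpace.1 (isClosed_coveringCodes T F).isCompact
  obtain ⟨δ, hδ, hfreq⟩ := exists_frequently_lt_of_upperBanachDensity_pos hA
  have hclopen : IsClopen {y : coveringCodes T K F | (y.1 0).1 = true} :=
    (isClopen_discrete {c : Bool × (Fin K → Fin r) | c.1 = true}).preimage
      (continuous_coveringCodes_apply T F 0)
  refine (exists_measurePreserving_le_measureReal (continuous_shiftCode T F 1) hclopen (δ := δ)
    fun L => ?_).imp fun μ h => ⟨h.1, h.2.1, hδ.trans_le h.2.2⟩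
  obtain ⟨p, hp1, hp2⟩ := (hfreq.and_eventually (eventually_longIntervals_le L)).exists
  obtain ⟨t, ht⟩ := hcov (Finset.Icc p.1 p.2)
  -- Only times of `A` inside the interval are marked. Unmarked times impose nothing, so a finite
  -- covering already gives a full code.
  let y : coveringCodes T K F := ⟨fun n => (decide (n ∈ Finset.Icc p.1 p.2 ∧ n ∈ A), t n),
    fun x => by
      obtain ⟨j, hj⟩ := ht x
      refine ⟨j, fun n hn => ?_⟩
      have hn' := of_decide_eq_true hn
      exact hj n hn'.1 hn'.2⟩
  -- Starting from the shift by `p.1` makes the orbit segment count exactly `A ∩ [p.1, p.2]`.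
  refine ⟨(p.2 + 1 - p.1).toNat, by omega, shiftCode T F p.1 y, ?_⟩
  have hlen : (((p.2 + 1 - p.1).toNat : ℕ) : ℝ) = (p.2 : ℝ) - p.1 + 1 := by
    have : (((p.2 + 1 - p.1).toNat : ℤ) : ℝ) = ((p.2 + 1 - p.1 : ℤ) : ℝ) := by
      rw [Int.toNat_of_nonneg (by omega)]
    push_cast at this
    linarith
  have hL : (0 : ℝ) < (p.2 : ℝ) - p.1 + 1 := by
    have : (0 : ℝ) ≤ ((p.2 - p.1 : ℤ) : ℝ) := by exact_mod_cast (Int.natCast_nonneg L).trans hp2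
    push_cast at this
    linarith
  have hsum : ∑ i ∈ Finset.range (p.2 + 1 - p.1).toNat,
      {y : coveringCodes T K F | (y.1 0).1 = true}.indicator (fun _ => (1 : ℝ))
        ((shiftCode T F 1)^[i] (shiftCode T F p.1 y)) = ((A ∩ Icc p.1 p.2).ncard : ℝ) := by
    have hcard : (A ∩ Icc p.1 p.2).ncard = {n ∈ Finset.Icc p.1 p.2 | n ∈ A}.card := by
      rw [← Set.ncard_coe_finset]
      congr 1
      ext n
      simp [and_comm]
    rw [hcard, ← Finset.sum_boole, sum_Icc_int_eq_sum_range]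
    refine Finset.sum_congr rfl fun i hi => ?_
    rw [iterate_shiftCode, shiftCode_shiftCode, indicator_apply]
    have hmem : p.1 + i ∈ Finset.Icc p.1 p.2 := by
      rw [Finset.mem_range] at hi
      rw [Finset.mem_Icc]
      omega
    have hiff : shiftCode T F (i + p.1) y ∈ {y : coveringCodes T K F | (y.1 0).1 = true} ↔
        p.1 + i ∈ A := by
      simp only [shiftCode, y, mem_ofPred_eq, decide_eq_true_eq, zero_add, add_comm (i : ℤ)]
      exact and_iff_right hmem
    simp only [hiff]
  rw [hsum, hlen]
  exact ((lt_div_iff₀ hL).1 hp1).le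

/-- If the space is covered by `K` itineraries in a finite family of closed sets along every finite
part of a set of positive upper Banach density, then for some nonempty open set and some member of
the family, the return times avoid a Bohr set up to a set of upper Banach density zero. -/
theorem exists_returnTimes_inter_not_pos [CompactSpace X] [T2Space X] [SecondCountableTopology X]
    [Nonempty X] (hF : ∀ i, IsClosed (F i)) {A : Set ℤ} (hA : 0 < upperBanachDensity A)
    (hcov : ∀ s : Finset ℤ, ∃ t : ℤ → Fin K → Fin r, ∀ x, ∃ j, ∀ n ∈ s, n ∈ A →
      (T ^ n : X ≃ₜ X) x ∈ F (t n j)) :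
    ∃ V : Set X, IsOpen V ∧ V.Nonempty ∧ ∃ u, ∃ B, IsBohrSet B ∧
      ¬ 0 < upperBanachDensity (returnTimes T V (F u)ᶜ ∩ B) := by
  obtain ⟨μ, hμ1, hμ2, hμ3⟩ := exists_measurePreserving_shiftCode T F hA hcov
  let 𝓑 := TopologicalSpace.countableBasis X
  have hsub : {y : coveringCodes T K F | (y.1 0).1 = true} ⊆
      ⋃ (V : 𝓑) (j : Fin K) (u : Fin r), cylinder T F V j u := by
    intro y hy
    -- Baire category: finitely many closed itinerary sets cover `X`, so one has interior.
    obtain ⟨j, x, hx⟩ := nonempty_interior_of_iUnion_of_closed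
      (isClosed_itinerarySet T F hF y.1) (iUnion_eq_univ_iff.2 y.2)
    obtain ⟨V, hV, -, hVs⟩ := (TopologicalSpace.isBasis_countableBasis X).exists_subset_of_mem_open
      hx isOpen_interior
    simp only [mem_iUnion]
    exact ⟨⟨V, hV⟩, j, (y.1 0).2 j, fun z hz => interior_subset (hVs hz), hy, rfl⟩
  obtain ⟨V, j, u, hpos⟩ : ∃ (V : 𝓑) (j : Fin K) (u : Fin r), μ (cylinder T F V j u) ≠ 0 := by
    by_contra! h
    have : Countable 𝓑 := (TopologicalSpace.countable_countableBasis X).to_subtype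
    have h0 := measure_mono_null hsub (measure_iUnion_null fun V => measure_iUnion_null fun j =>
      measure_iUnion_null fun u => h V j u)
    simp [Measure.real, h0] at hμ3
  have hCm : MeasurableSet (cylinder T F V j u) := (isClosed_cylinder T F V j u).measurableSet
  let φ : ℤ → ℝ := fun n =>
    μ.real (shiftCode T F n ⁻¹' cylinder T F V j u ∩ cylinder T F V j u)
  have hshift := measurePreserving_shiftCode T F hμ2
  have hφ : ∀ m n, μ.real (shiftCode T F m ⁻¹' cylinder T F V j u ∩
      shiftCode T F n ⁻¹' cylinder T F V j u) = φ (m - n) := by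
    intro m n
    have hinv := (hshift n).measureReal_preimage
      (((hshift (m - n)).measurable hCm).inter hCm).nullMeasurableSet
    have hcomp : shiftCode T F (K := K) (m - n) ∘ shiftCode T F n = shiftCode T F m :=
      funext fun y => by simp [shiftCode_shiftCode]
    rwa [preimage_inter, ← preimage_comp, hcomp] at hinv
  have h0 : 0 < φ 0 := by
    have hid : shiftCode T F (K := K) 0 = id := funext (shiftCode_zero T F)
    simp only [φ, hid, preimage_id, inter_self]
    exact ENNReal.toReal_pos hpos (measure_ne_top _ _)
  obtain ⟨B, hB, h⟩ := exists_isBohrSet_of_stationary μ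
    (fun n => (hshift n).measurable hCm) hφ h0
  refine ⟨V, (TopologicalSpace.isBasis_countableBasis X).isOpen V.2,
    TopologicalSpace.nonempty_of_mem_countableBasis V.2, u, B, hB,
    h _ inter_subset_right fun n hn => ?_⟩
  have hempty : shiftCode T F n ⁻¹' cylinder T F V j u ∩ cylinder T F V j u = ∅ :=
    eq_empty_of_forall_notMem fun y hy =>
      returnTimes_subset_of_cylinder T F hy.2 hy.1 hn.1
  simp [φ, hempty]

/-- A bound on the complexity along `a` gives boundedly many itineraries that cover the space along
any finite part of the range of `a`. -/
theorem exists_itineraries_of_frequently_coverNumber_le [Nonempty X] {U : Fin r → Set X}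
    {a : ℕ → ℕ} (ha : Function.Injective a)
    (hK : ∃ᶠ n in atTop, coverNumber (joinAlong T (range U) a n) ≤ K) (s : Finset ℤ) :
    ∃ t : ℤ → Fin K → Fin r, ∀ x, ∃ j, ∀ n ∈ s, n ∈ range (fun i => (a i : ℤ)) →
      (T ^ n : X ≃ₜ X) x ∈ U (t n j) := by
  have ha' : Function.Injective (fun i => (a i : ℤ)) := fun i j h =>
    ha (Nat.cast_injective h)
  -- `N` bounds the indices of the terms of `a` in `s`, so a join of length at least `N + 1` sees
  -- all of them.
  obtain ⟨N, hN⟩ := (s.finite_toSet.preimage ha'.injOn).bddAbove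
  obtain ⟨n, hNn, hn⟩ := (frequently_atTop.1 hK) (N + 1)
  obtain ⟨𝒱, h𝒱, hcov, hcard⟩ := exists_subset_encard_le_of_coverNumber_le hn
  have hne : 𝒱.Nonempty := by
    obtain ⟨x⟩ := ‹Nonempty X›
    obtain ⟨W, hW, -⟩ := mem_sUnion.1 (hcov ▸ mem_univ x)
    exact ⟨W, hW⟩
  obtain ⟨W, rfl⟩ := exists_fin_range_eq_of_encard_le hne hcard
  have hW : ∀ j, ∃ q : Fin n → Fin r, W j = ⋂ i : Fin n, (T ^ (a i) : X ≃ₜ X) ⁻¹' U (q i) := by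
    intro j
    obtain ⟨σ, hσ, hWj⟩ := h𝒱 (mem_range_self j)
    choose q hq using hσ
    exact ⟨q, by simp_rw [hq, hWj]⟩
  choose q hq using hW
  classical
  have hr : n ≠ 0 := by omega
  -- At times not among the first `n` terms the symbol is irrelevant, and the entry at index `0` is
  -- a filler. At the others, injectivity of `a` makes the chosen index the right one.
  refine ⟨fun m j => if h : ∃ i : Fin n, (a i : ℤ) = m then q j h.choose
    else q j ⟨0, by omega⟩, fun x => ?_⟩
  obtain ⟨_, ⟨j, rfl⟩, hx⟩ := mem_sUnion.1 (hcov ▸ mem_univ x)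
  refine ⟨j, ?_⟩
  rintro _ hm ⟨i, rfl⟩
  have hi : i < n := by
    have : i ≤ N := hN hm
    omega
  have hex : ∃ i' : Fin n, (a i' : ℤ) = (a i : ℤ) := ⟨⟨i, hi⟩, rfl⟩
  have hch : (hex.choose : ℕ) = i := ha' hex.choose_spec
  rw [hq, mem_iInter] at hx
  have := hx hex.choose
  simp only [hex, dite_true, zpow_natCast]
  rwa [mem_preimage, hch] at this

end TopDyn

theorem mainTheorem7 {X : Type*} [MetricSpace X] [CompactSpace X] [Nonempty X] (T : X ≃ₜ X)
    (hweak : TopDyn.IsWeaklyScattering T)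
    (hdens : ∀ U V : Set X, IsOpen U → U.Nonempty → IsOpen V → V.Nonempty →
      ∀ B : Set ℤ, TopDyn.IsBohrSet B →
        0 < TopDyn.upperBanachDensity (TopDyn.returnTimes T U V ∩ B)) :
    TopDyn.IsStronglyScattering T := by
  intro 𝒰 h𝒰 a ha hA
  rw [ENat.tendsto_nhds_top_iff_natCast_lt]
  by_contra! h
  obtain ⟨K, hK⟩ := h
  have hK' : ∃ᶠ n in atTop, TopDyn.coverNumber (TopDyn.joinAlong T 𝒰 a n) ≤ K := by
    simpa [Filter.Frequently] using hK
  obtain ⟨r, U, -, rfl⟩ := h𝒰.finite.fin_param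
  -- Passing to closures allows the Baire argument; a non-dense set still has a closure with
  -- nonempty open complement.
  obtain ⟨V, hV, hVne, u, B, hB, hnot⟩ := TopDyn.exists_returnTimes_inter_not_pos T (K := K)
    (fun i => closure (U i)) (fun i => isClosed_closure) hA fun s => by
      obtain ⟨t, ht⟩ := TopDyn.exists_itineraries_of_frequently_coverNumber_le T ha hK' s
      refine ⟨t, fun x => ?_⟩
      obtain ⟨j, hj⟩ := ht x
      exact ⟨j, fun n hn hnA => subset_closure (hj n hn hnA)⟩
  have hne : (closure (U u))ᶜ.Nonempty := by
    rw [nonempty_compl, Ne, ← dense_iff_closure_eq]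
    exact h𝒰.not_dense _ (mem_range_self u)
  exact hnot (hdens V _ hV hVne isClosed_closure.isOpen_compl hne B hB)
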